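/- Let $\mathbb B=\{A\in M_2(\mathbb C):\|A\|<1\}$ (operator norm on Euclidean $\mathbb C^2$), let $\mathcal P=\{(a_{21},\operatorname{tr}A,\det A):A=(a_{ij})\in\mathbb B\}$ be the pentablock, $\overline{\mathcal P}=\{(a_{21},\operatorname{tr}A,\det A):\|A\|\le 1\}$ the closed pentablock, and let $b\mathcal P$ be its distinguished boundary, i.e. the smallest closed subset of $\overline{\mathcal P}$ on which every function continuous on $\overline{\mathcal P}$ and holomorphic on $\mathcal P$ attains its maximum modulus. All Hilbert spaces are complex and all operators bounded. A *$\overline{\mathcal P}$-contraction* is a commuting triple for which $\overline{\mathcal P}$ is a spectral set: its Taylor joint spectrum lies in $\overline{\mathcal P}$, and the unital homomorphism $z_i\mapsto P_i$ from the functions holomorphic near $\overline{\mathcal P}$ to the bounded operators is contractive for the supremum norm on $\overline{\mathcal P}$. A *$\overline{\mathcal P}$-unitary* is a commuting triple of normal operators with Taylor joint spectrum in $b\mathcal P$, and a *$\overline{\mathcal P}$-isometry* is the restriction of a $\overline{\mathcal P}$-unitary to a joint invariant closed subspace. A *$\overline{\mathcal P}$-isometric dilation* of $(P_1,P_2,P_3)$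 on $\mathcal H$ is a $\overline{\mathcal P}$-isometry $(R_1,R_2,R_3)$ on a Hilbert space $\mathcal K\supseteq\mathcal H$ with $R_i^*|_{\mathcal H}=P_i^*$ for $i=1,2,3$. For a contraction $T$ put $D_T=(I-T^*T)^{1/2}$ and $\mathcal D_T=\overline{\operatorname{Ran}}\,D_T$. The *fundamental operator* of $(P_1,P_2,P_3)$ is the unique $X\in\mathcal B(\mathcal D_{P_3})$ with $P_2-P_2^*P_3=D_{P_3}XD_{P_3}$. An operator is *subnormal* if it is the restriction of a normal operator to a closed invariant subspace. **Theorem.** Let $(P_1,P_2,P_3)$ be a $\overline{\mathcal P}$-contraction on a Hilbert space $\mathcal H$ with fundamental operator $X\in\mathcal B(\mathcal D_{P_3})$. If $(P_1,P_2,P_3)$ has a $\overline{\mathcal P}$-isometric dilation, then both of the following hold. 1. There are a Hilbert space $\mathcal F$, an isometric embedding $\Theta:\mathcal D_{P_3}\to\mathcal F$ and commuting subnormal operators $N_1,N_2,N_3$ on $\mathcal F$ such that $X=\Theta^*N_2\Theta$ and $(N_1,N_2,N_3)$ extends to a commuting triple $(U_1,U_2,U_3)$ of normal operators, on a Hilbert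 space containing $\mathcal F$, whose Taylor joint spectrum is contained in $b\mathcal P$. 2. $(X^*D_{P_3}P_3-D_{P_3}P_2)\big|_{\operatorname{Ker}D_{P_3}}=0$. -/

import Mathlib

universe u

open scoped InnerProduct

noncomputable section

namespace Pentablock

/-! ### The pentablock and its distinguished boundary -/

/-- The coordinates `(a₂₁, tr A, det A)` of a `2 × 2` matrix. -/
def coords (A : Matrix (Fin 2) (Fin 2) ℂ) : Fin 3 → ℂ :=
  ![A 1 0, A.trace, A.det]

/-- The operator norm of a `2 × 2` matrix acting on Euclidean `ℂ²`. -/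
def opNorm (A : Matrix (Fin 2) (Fin 2) ℂ) : ℝ :=
  ‖Matrix.toEuclideanCLM (n := Fin 2) (𝕜 := ℂ) A‖

/-- The (open) pentablock `𝒫`. -/
def pentablock : Set (Fin 3 → ℂ) :=
  {x | ∃ A : Matrix (Fin 2) (Fin 2) ℂ, opNorm A < 1 ∧ x = coords A}

/-- The closed pentablock. -/
def closedPentablock : Set (Fin 3 → ℂ) :=
  {x | ∃ A : Matrix (Fin 2) (Fin 2) ℂ, opNorm A ≤ 1 ∧ x = coords A}

/-- The algebra of functions that are continuous on the closed pentablock and holomorphic on the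
pentablock. -/
def IsInDiscAlgebra (f : (Fin 3 → ℂ) → ℂ) : Prop :=
  ContinuousOn f closedPentablock ∧ DifferentiableOn ℂ f pentablock

/-- A closed subset of the closed pentablock on which every function of the algebra attains its
maximum modulus. -/
def IsClosedBoundary (F : Set (Fin 3 → ℂ)) : Prop :=
  IsClosed F ∧ F ⊆ closedPentablock ∧
    ∀ f, IsInDiscAlgebra f → ∀ z ∈ closedPentablock, ∃ w ∈ F, ‖f z‖ ≤ ‖f w‖

/-- The distinguished (Shilov) boundary `b𝒫`: the smallest closed boundary, that is, the
intersection of all closed boundaries. -/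
def distinguishedBoundary : Set (Fin 3 → ℂ) :=
  ⋂₀ {F | IsClosedBoundary F}

/-! ### Taylor joint spectrum and spectral sets -/

section Operators

variable {H : Type u} [NormedAddCommGroup H] [InnerProductSpace ℂ H]

/-- All members of the triple commute with each other. -/
def IsCommuting (T : Fin 3 → H →L[ℂ] H) : Prop :=
  ∀ i j, Commute (T i) (T j)

/-- First map `H → H³` of the Koszul complex of a triple. -/
def koszul₀ (T : Fin 3 → H →L[ℂ] H) (x : H) : Fin 3 → H :=
  fun i => T i x

/-- Second map `H³ → H³` of the Koszul complex of a triple. -/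
def koszul₁ (T : Fin 3 → H →L[ℂ] H) (x : Fin 3 → H) : Fin 3 → H :=
  ![T 1 (x 2) - T 2 (x 1), T 2 (x 0) - T 0 (x 2), T 0 (x 1) - T 1 (x 0)]

/-- Third map `H³ → H` of the Koszul complex of a triple. -/
def koszul₂ (T : Fin 3 → H →L[ℂ] H) (x : Fin 3 → H) : H :=
  ∑ i, T i (x i)

/-- Exactness of the Koszul complex `0 → H → H³ → H³ → H → 0` of a commuting triple. -/
def KoszulExact (T : Fin 3 → H →L[ℂ] H) : Prop :=
  Function.Injective (koszul₀ T) ∧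
  (∀ x, koszul₁ T x = 0 → ∃ y, koszul₀ T y = x) ∧
  (∀ x, koszul₂ T x = 0 → ∃ y, koszul₁ T y = x) ∧
  Function.Surjective (koszul₂ T)

/-- The Taylor joint spectrum of a commuting triple: the points `z` for which the Koszul complex
of `(T₁ - z₁, T₂ - z₂, T₃ - z₃)` is not exact. -/
def taylorSpectrum (T : Fin 3 → H →L[ℂ] H) : Set (Fin 3 → ℂ) :=
  {z | ¬ KoszulExact fun i => T i - z i • (1 : H →L[ℂ] H)}

end Operators

/-- The algebra of functions holomorphic on a neighbourhood of `Ω`. (Functions are total; their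
values away from `Ω` do not matter.) -/
def holoNear (Ω : Set (Fin 3 → ℂ)) : Subalgebra ℂ ((Fin 3 → ℂ) → ℂ) where
  carrier := {f | AnalyticOnNhd ℂ f Ω}
  mul_mem' hf hg := AnalyticOnNhd.mul hf hg
  add_mem' hf hg := AnalyticOnNhd.add hf hg
  algebraMap_mem' _ := analyticOnNhd_const

/-- The coordinate function `zᵢ` as an element of `holoNear Ω`. -/
def holoCoord (Ω : Set (Fin 3 → ℂ)) (i : Fin 3) : holoNear Ω :=
  ⟨fun z => z i, (ContinuousLinearMap.proj (R := ℂ) (φ := fun _ : Fin 3 => ℂ) i).analyticOnNhd Ω⟩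

section Hilbert

variable {H : Type u} [NormedAddCommGroup H] [InnerProductSpace ℂ H]

/-- `Ω` is a spectral set for the commuting triple `T`: the Taylor joint spectrum lies in `Ω`, and
there is a unital homomorphism from the holomorphic functions near `Ω` to the bounded operators
which sends `zᵢ` to `Tᵢ` and is contractive for the supremum norm on `Ω`. -/
def IsSpectralSet (Ω : Set (Fin 3 → ℂ)) (T : Fin 3 → H →L[ℂ] H) : Prop :=
  taylorSpectrum T ⊆ Ω ∧
    ∃ ρ : holoNear Ω →ₐ[ℂ] (H →L[ℂ] H),
      (∀ i, ρ (holoCoord Ω i) = T i) ∧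
      ∀ (f : holoNear Ω) (M : ℝ), 0 ≤ M → (∀ z ∈ Ω, ‖(f : (Fin 3 → ℂ) → ℂ) z‖ ≤ M) → ‖ρ f‖ ≤ M

/-! ### Pentablock contractions, unitaries, isometries and isometric dilations -/

/-- A commuting triple which has the closed pentablock as a spectral set. -/
def IsPentablockContraction (T : Fin 3 → H →L[ℂ] H) : Prop :=
  IsCommuting T ∧ IsSpectralSet closedPentablock T

variable [CompleteSpace H]

/-- A commuting triple of normal operators. -/
def IsCommutingNormal (U : Fin 3 → H →L[ℂ] H) : Prop :=
  IsCommuting U ∧ ∀ i, IsStarNormal (U i)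

/-- A commuting triple of normal operators with Taylor joint spectrum in `b𝒫`. -/
def IsPentablockUnitary (U : Fin 3 → H →L[ℂ] H) : Prop :=
  IsCommutingNormal U ∧ taylorSpectrum U ⊆ distinguishedBoundary

/-- A pentablock isometry: the restriction of a pentablock unitary to a joint invariant subspace.
The subspace is the range of an isometric embedding `J` that intertwines the two triples. -/
def IsPentablockIsometry (R : Fin 3 → H →L[ℂ] H) : Prop :=
  ∃ (L : Type u) (_ : NormedAddCommGroup L) (_ : InnerProductSpace ℂ L) (_ : CompleteSpace L)
    (J : H →ₗᵢ[ℂ] L) (U : Fin 3 → L →L[ℂ] L),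
    IsPentablockUnitary U ∧ ∀ i x, U i (J x) = J (R i x)

/-- The triple `P` has a pentablock-isometric dilation: a pentablock isometry `R` on a Hilbert
space `K` which contains `H` (through the isometric embedding `J`), with `Rᵢ*|_H = Pᵢ*`. -/
def HasPentablockIsometricDilation (P : Fin 3 → H →L[ℂ] H) : Prop :=
  ∃ (K : Type u) (_ : NormedAddCommGroup K) (_ : InnerProductSpace ℂ K) (_ : CompleteSpace K)
    (J : H →ₗᵢ[ℂ] K) (R : Fin 3 → K →L[ℂ] K),
    IsCommuting R ∧ IsPentablockIsometry R ∧ ∀ i x, ((R i)†) (J x) = J (((P i)†) x)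

/-- A subnormal operator: one that has a normal extension. -/
def IsSubnormalOperator (N : H →L[ℂ] H) : Prop :=
  ∃ (L : Type u) (_ : NormedAddCommGroup L) (_ : InnerProductSpace ℂ L) (_ : CompleteSpace L)
    (J : H →ₗᵢ[ℂ] L) (U : L →L[ℂ] L), IsStarNormal U ∧ ∀ x, U (J x) = J (N x)

/-! ### Defect operators and the fundamental operator -/

/-- The defect operator `D_T = (I - T*T)^{1/2}` of a contraction. -/
def defectOp (T : H →L[ℂ] H) : H →L[ℂ] H :=
  CFC.sqrt (1 - (T†) * T)

/-- The defect space `𝒟_T`, the closure of the range of `D_T`. -/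
abbrev DefectSpace (T : H →L[ℂ] H) : Submodule ℂ H :=
  (LinearMap.range (defectOp T : H →ₗ[ℂ] H)).topologicalClosure

/-- The defect operator as a map into the defect space. -/
def defectMap (T : H →L[ℂ] H) : H →L[ℂ] DefectSpace T :=
  (defectOp T).codRestrict (DefectSpace T) fun x =>
    Submodule.le_topologicalClosure _ ⟨x, rfl⟩

/-- `X ∈ ℬ(𝒟_{P₃})` is the fundamental operator of `(P₁, P₂, P₃)`: it solves the fundamental
equation `P₂ - P₂* P₃ = D_{P₃} X D_{P₃}`, whose solution is unique. -/
def IsFundamentalOperator (P : Fin 3 → H →L[ℂ] H)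
    (X : DefectSpace (P 2) →L[ℂ] DefectSpace (P 2)) : Prop :=
  P 1 - ((P 1)†) * P 2 = defectOp (P 2) ∘L (DefectSpace (P 2)).subtypeL ∘L X ∘L defectMap (P 2)

end Hilbert

end Pentablock

end

/-!
A pentablock isometry `(R₁, R₂, R₃)` satisfies `R₃* R₃ = 1` and `R₂ = R₂* R₃`
(`inner_eq_of_isPentablockIsometry`), and these two relations carry the theorem.
Comments number the members of a triple from one, so that `R₃` is `R 2` in the code.

Let `R` on `K ⊇ H` be an isometric dilation of `P`. Since `Rᵢ*` leaves `H` invariant and restricts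
to `Pᵢ*` there, the orthogonal complement `F = K ⊖ H` is invariant under `R`, and the component of
`R₃ h` in `F` is `E h = R₃ h - P₃ h`. As `R₃` is isometric, `‖E h‖² = ‖h‖² - ‖P₃ h‖² = ‖D h‖²`,
where `D` is the defect operator of `P₃`. Hence `D h ↦ E h` extends to an isometry `Θ` from the
defect space into `F`. With `N = R|_F`, the relation `R₂ = R₂* R₃` gives
`⟪E h, N₂ E k⟫ = ⟪h, (P₂ - P₂* P₃) k⟫ = ⟪D h, X D k⟫`
(`inner_dilationDefect_orthogonalRestriction`), that is, `X = Θ* N₂ Θ`. The normal extension of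
`R` which makes it a pentablock isometry is also one of `N`.

If `D h = 0`, then `E h = 0`, so `R₃ h = P₃ h ∈ H`, and the relation `R₂ = R₂* R₃` becomes `⟪P₃ h,
P₂ k⟫ = ⟪P₂ h, k⟫` for all `k` in `H` (`inner_apply_of_defectOp_eq_zero`). Paired with `D k`, the
second assertion is this identity, up to the fundamental equation and `P₂ P₃ = P₃ P₂`.

The two relations for `R` come from the corresponding ones for a pentablock unitary `U`. There,
the points `(φ(U₁), φ(U₂), φ(U₃))`, with `φ` a character of the commutative C⋆-algebra generated
by `U`, lie in the Taylor spectrum (`mem_taylorSpectrum_of_starAlgHom`), hence in the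
distinguished boundary, and characters separate the elements of the algebra. On the distinguished
boundary `|z₃| = 1` and `z₂ = z̄₂ z₃`, because the unitary matrices already form a closed boundary
(`isClosedBoundary_unitaryCoords`): in a singular value decomposition `W diag(σ₁, σ₂) V` the
maximum principle moves `σ₁` and `σ₂` to the unit circle.
-/

noncomputable section

namespace Pentablock

/-! ### Unitary matrices and the distinguished boundary -/

section Boundary

open Matrix

/-- Every complex square matrix is `W * diagonal σ * V` with `W`, `V` unitary. The columns of `V*`
are eigenvectors of `A* A`, whose images under `A` are orthogonal; the normalized nonzero images
are completed to an orthonormal basis, which gives the columns of `W`. -/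
lemma exists_singularValueDecomposition {n : Type*} [Fintype n] [DecidableEq n]
    (A : Matrix n n ℂ) :
    ∃ W ∈ unitaryGroup n ℂ, ∃ V ∈ unitaryGroup n ℂ, ∃ σ : n → ℝ,
      A = W * diagonal (fun i => (σ i : ℂ)) * V := by
  have hA : (Aᴴ * A).IsHermitian := isHermitian_conjTranspose_mul_self A
  set V : Matrix n n ℂ := (hA.eigenvectorUnitary : Matrix n n ℂ) with hV
  have hVu : V ∈ unitaryGroup n ℂ := hA.eigenvectorUnitary.2
  have hVV : V * Vᴴ = 1 := mem_unitaryGroup_iff.mp hVu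
  set b : n → EuclideanSpace ℂ n := fun j => WithLp.toLp 2 fun i => (A * V) i j with hb
  have hinner : ∀ i j, inner ℂ (b i) (b j) = ((A * V)ᴴ * (A * V)) i j := by
    intro i j
    simp [hb, EuclideanSpace.inner_eq_star_dotProduct, Matrix.mul_apply, dotProduct, mul_comm]
  have hdiag : (A * V)ᴴ * (A * V) = diagonal (fun i => (hA.eigenvalues i : ℂ)) := by
    have h := hA.conjStarAlgAut_star_eigenvectorUnitary
    rw [Unitary.conjStarAlgAut_star_apply] at h
    rw [conjTranspose_mul, ← mul_assoc, mul_assoc Vᴴ]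
    exact h
  have horth : ∀ i j, i ≠ j → inner ℂ (b i) (b j) = 0 := by
    intro i j hij
    rw [hinner, hdiag, diagonal_apply_ne _ hij]
  obtain ⟨w, hw⟩ := Orthonormal.exists_orthonormalBasis_extension_of_card_eq
    (𝕜 := ℂ) (E := EuclideanSpace ℂ n) (ι := n) finrank_euclideanSpace
    (v := fun j => ((‖b j‖ : ℂ)⁻¹) • b j) (s := {j | b j ≠ 0}) (by
      refine ⟨fun j => ?_, fun i j hij => ?_⟩
      · have : ‖b j‖ ≠ 0 := norm_ne_zero_iff.mpr j.2
        simp [norm_smul, this]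
      · have : (i : n) ≠ j := fun h => hij (Subtype.ext h)
        simp [inner_smul_left, inner_smul_right, horth _ _ this])
  have hbw : ∀ j, b j = (‖b j‖ : ℂ) • w j := by
    intro j
    by_cases h : b j = 0
    · simp [h]
    · rw [hw j h, smul_smul, mul_inv_cancel₀, one_smul]
      simpa using h
  refine ⟨(EuclideanSpace.basisFun n ℂ).toBasis.toMatrix w.toBasis,
    by simpa using (EuclideanSpace.basisFun n ℂ).toMatrix_orthonormalBasis_mem_unitary w,
    Vᴴ, ?_, fun j => ‖b j‖, ?_⟩
  · exact Unitary.star_mem hVu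
  · have hAV : A * V = (EuclideanSpace.basisFun n ℂ).toBasis.toMatrix w.toBasis *
        diagonal (fun j => ((‖b j‖ : ℝ) : ℂ)) := by
      ext i j
      have := congrArg (fun x : EuclideanSpace ℂ n => x i) (hbw j)
      simp only [hb, PiLp.smul_apply, smul_eq_mul] at this
      rw [mul_diagonal, this, mul_comm]
      simp [Module.Basis.toMatrix_apply, hb]
    rw [← hAV, mul_assoc, hVV, mul_one]

lemma opNorm_unitary_mul_mul {W V : Matrix (Fin 2) (Fin 2) ℂ} (hW : W ∈ unitaryGroup (Fin 2) ℂ)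
    (hV : V ∈ unitaryGroup (Fin 2) ℂ) (A : Matrix (Fin 2) (Fin 2) ℂ) :
    opNorm (W * A * V) = opNorm A := by
  unfold opNorm
  rw [map_mul, map_mul]
  exact (CStarRing.norm_mul_mem_unitary _ (Unitary.map_mem _ hV)).trans
    (CStarRing.norm_mem_unitary_mul _ (Unitary.map_mem _ hW))

lemma opNorm_diagonal (d : Fin 2 → ℂ) : opNorm (diagonal d) = ‖d‖ :=
  Matrix.l2_opNorm_diagonal d

lemma opNorm_of_mem_unitaryGroup {W : Matrix (Fin 2) (Fin 2) ℂ}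
    (hW : W ∈ unitaryGroup (Fin 2) ℂ) : opNorm W = 1 :=
  CStarRing.norm_of_mem_unitary (Unitary.map_mem _ hW)

lemma isCompact_unitaryGroup {n : Type*} [Fintype n] [DecidableEq n] :
    IsCompact (unitaryGroup n ℂ : Set (Matrix n n ℂ)) := by
  have hsub : (unitaryGroup n ℂ : Set (Matrix n n ℂ)) ⊆
      Set.pi Set.univ fun _ => Set.pi Set.univ fun _ => Metric.closedBall (0 : ℂ) 1 := by
    intro U hU i _ j _
    simpa using entry_norm_bound_of_unitary hU i j
  refine IsCompact.of_isClosed_subset (isCompact_univ_pi fun _ => isCompact_univ_pi fun _ =>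
    isCompact_closedBall (0 : ℂ) 1) ?_ hsub
  have : (unitaryGroup n ℂ : Set (Matrix n n ℂ)) = {U | U * star U = 1} := by
    ext U
    exact mem_unitaryGroup_iff
  rw [this]
  exact isClosed_eq (by fun_prop) continuous_const

lemma continuous_coords : Continuous coords := by
  refine continuous_pi fun i => ?_
  fin_cases i <;> simp [coords, trace_fin_two, det_fin_two] <;> fun_prop

lemma differentiable_coords_comp {A : ℂ → Matrix (Fin 2) (Fin 2) ℂ}
    (hA : ∀ i j, Differentiable ℂ fun t => A t i j) : Differentiable ℂ fun t => coords (A t) := by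
  rw [differentiable_pi]
  intro i
  have h00 := hA 0 0
  have h01 := hA 0 1
  have h10 := hA 1 0
  have h11 := hA 1 1
  fin_cases i <;> simp [coords, trace_fin_two, det_fin_two] <;> fun_prop

/-- The `(a₂₁, tr, det)` coordinates of the unitary `2 × 2` matrices. -/
def unitaryCoords : Set (Fin 3 → ℂ) :=
  coords '' (unitaryGroup (Fin 2) ℂ : Set (Matrix (Fin 2) (Fin 2) ℂ))

/-- The maximum principle on the polydisc of radius `r < 1`, in one of the two variables. -/
lemma exists_norm_le_update {f : (Fin 3 → ℂ) → ℂ} (hf : DifferentiableOn ℂ f pentablock)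
    {W V : Matrix (Fin 2) (Fin 2) ℂ} (hW : W ∈ unitaryGroup (Fin 2) ℂ)
    (hV : V ∈ unitaryGroup (Fin 2) ℂ) {r : ℝ} (hr0 : 0 < r) (hr1 : r < 1)
    (d : Fin 2 → ℂ) (hd : ‖d‖ ≤ r) (i : Fin 2) :
    ∃ t : ℂ, ‖t‖ = r ∧
      ‖f (coords (W * diagonal d * V))‖ ≤
        ‖f (coords (W * diagonal (Function.update d i t) * V))‖ := by
  set g : ℂ → ℂ := fun t => f (coords (W * diagonal (Function.update d i t) * V)) with hg
  -- The other entry of `d` has modulus at most `r < 1`, so that the whole open unit disc is mapped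
  -- into the open pentablock and `g` is holomorphic beyond the closed disc of radius `r`.
  have hdiff : DifferentiableOn ℂ g (Metric.ball 0 1) := by
    refine hf.comp (g := f) (f := fun t => coords (W * diagonal (Function.update d i t) * V))
      (Differentiable.differentiableOn <| differentiable_coords_comp fun a b => ?_) fun t ht => ?_
    · simp only [mul_apply, Fin.sum_univ_two, diagonal_apply, Function.update_apply]
      fin_cases i <;> simp <;> fun_prop
    · refine ⟨_, ?_, rfl⟩
      rw [opNorm_unitary_mul_mul hW hV, opNorm_diagonal, pi_norm_lt_iff one_pos]
      intro j
      by_cases hj : j = i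
      · subst hj
        simpa using ht
      · rw [Function.update_of_ne hj]
        exact ((norm_le_pi_norm d j).trans hd).trans_lt hr1
  have hcl : DiffContOnCl ℂ g (Metric.ball 0 r) :=
    DifferentiableOn.diffContOnCl <| hdiff.mono <|
      (closure_ball (0 : ℂ) hr0.ne') ▸ Metric.closedBall_subset_ball hr1
  obtain ⟨t, ht, hmax⟩ := Complex.exists_mem_frontier_isMaxOn_norm Metric.isBounded_ball
    ⟨0, Metric.mem_ball_self hr0⟩ hcl
  rw [frontier_ball _ hr0.ne', mem_sphere_zero_iff_norm] at ht
  refine ⟨t, ht, ?_⟩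
  have hdi : d i ∈ closure (Metric.ball (0 : ℂ) r) := by
    rw [closure_ball _ hr0.ne', mem_closedBall_zero_iff]
    exact (norm_le_pi_norm d i).trans hd
  simpa [hg] using hmax hdi

/-- The maximum principle on the ball of radius `r < 1`: the singular values of a matrix are
moved, one after the other, to the circle of radius `r`, where the matrix is `r` times a unitary.
-/
lemma exists_unitary_norm_le_of_lt_one {f : (Fin 3 → ℂ) → ℂ}
    (hf : DifferentiableOn ℂ f pentablock) {r : ℝ} (hr0 : 0 < r) (hr1 : r < 1)
    {A : Matrix (Fin 2) (Fin 2) ℂ} (hA : opNorm A ≤ 1) :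
    ∃ U ∈ unitaryGroup (Fin 2) ℂ,
      ‖f (coords ((r : ℂ) • A))‖ ≤ ‖f (coords ((r : ℂ) • U))‖ := by
  obtain ⟨W, hW, V, hV, σ, rfl⟩ := exists_singularValueDecomposition A
  rw [opNorm_unitary_mul_mul hW hV, opNorm_diagonal] at hA
  have hsm : ∀ d : Fin 2 → ℂ, (r : ℂ) • (W * diagonal d * V) = W * diagonal ((r : ℂ) • d) * V := by
    intro d
    rw [diagonal_smul, Matrix.mul_smul, Matrix.smul_mul]
  rw [hsm]
  set d₀ : Fin 2 → ℂ := (r : ℂ) • fun i => (σ i : ℂ)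
  have hd₀ : ‖d₀‖ ≤ r := by
    rw [norm_smul, Complex.norm_real, Real.norm_of_nonneg hr0.le]
    exact mul_le_of_le_one_right hr0.le hA
  obtain ⟨s, hs, h1⟩ := exists_norm_le_update hf hW hV hr0 hr1 d₀ hd₀ 0
  have hd₁ : ‖Function.update d₀ 0 s‖ ≤ r := by
    rw [pi_norm_le_iff_of_nonneg hr0.le]
    intro j
    by_cases hj : j = 0
    · subst hj
      simp [hs]
    · rw [Function.update_of_ne hj]
      exact (norm_le_pi_norm d₀ j).trans hd₀
  obtain ⟨t, ht, h2⟩ := exists_norm_le_update hf hW hV hr0 hr1 _ hd₁ 1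
  set d₂ := Function.update (Function.update d₀ 0 s) 1 t
  have hd₂ : ∀ j, ‖d₂ j‖ = r := by
    intro j
    fin_cases j <;> simp [d₂, hs, ht]
  have hr : (r : ℂ) ≠ 0 := by exact_mod_cast hr0.ne'
  have hU : diagonal ((r : ℂ)⁻¹ • d₂) ∈ unitaryGroup (Fin 2) ℂ := by
    rw [mem_unitaryGroup_iff, star_eq_conjTranspose, diagonal_conjTranspose, diagonal_mul_diagonal,
      ← diagonal_one]
    congr 1
    ext j
    simp only [Pi.star_apply, RCLike.star_def, Complex.mul_conj']
    simp [hd₂, hr0.ne', abs_of_pos hr0]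
  refine ⟨W * diagonal ((r : ℂ)⁻¹ • d₂) * V, mul_mem (mul_mem hW hU) hV, ?_⟩
  rw [hsm, smul_smul, mul_inv_cancel₀ hr, one_smul]
  exact h1.trans h2

lemma opNorm_smul (c : ℂ) (A : Matrix (Fin 2) (Fin 2) ℂ) : opNorm (c • A) = ‖c‖ * opNorm A := by
  unfold opNorm
  rw [map_smul, norm_smul]

lemma unitaryCoords_subset : unitaryCoords ⊆ closedPentablock := by
  rintro _ ⟨U, hU, rfl⟩
  exact ⟨U, (opNorm_of_mem_unitaryGroup hU).le, rfl⟩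

open Filter Topology in
/-- The unitary matrices give a closed boundary: this is the maximum principle on the balls of
radius `r < 1`, followed by a compactness argument as `r → 1`. -/
lemma isClosedBoundary_unitaryCoords : IsClosedBoundary unitaryCoords := by
  refine ⟨(isCompact_unitaryGroup.image continuous_coords).isClosed, unitaryCoords_subset, ?_⟩
  rintro f ⟨hcont, hdiff⟩ _ ⟨A, hA, rfl⟩
  set r : ℕ → ℝ := fun n => 1 - 1 / ((n : ℝ) + 2) with hr
  have hr0 : ∀ n, 0 < r n := fun n => by
    have : (1 : ℝ) / ((n : ℝ) + 2) < 1 := by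
      rw [div_lt_one (by positivity)]
      have : (0 : ℝ) ≤ n := n.cast_nonneg
      linarith
    simp only [hr]
    linarith
  have hr1 : ∀ n, r n < 1 := fun n => by
    have : (0 : ℝ) < 1 / ((n : ℝ) + 2) := by positivity
    simp only [hr]
    linarith
  have hrlim : Tendsto (fun n => (r n : ℂ)) atTop (𝓝 1) := by
    have h : Tendsto r atTop (𝓝 (1 - 0)) := by
      refine tendsto_const_nhds.sub ?_
      have := tendsto_one_div_add_atTop_nhds_zero_nat (𝕜 := ℝ)
      refine ((tendsto_add_atTop_iff_nat 1).mpr this).congr fun n => ?_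
      push_cast
      ring
    rw [sub_zero] at h
    exact_mod_cast (Complex.continuous_ofReal.tendsto 1).comp h
  choose U hU hle using fun n => exists_unitary_norm_le_of_lt_one hdiff (hr0 n) (hr1 n) hA
  have : FirstCountableTopology (Matrix (Fin 2) (Fin 2) ℂ) :=
    inferInstanceAs (FirstCountableTopology (Fin 2 → Fin 2 → ℂ))
  obtain ⟨U₀, hU₀, φ, hφ, hlim⟩ := isCompact_unitaryGroup.tendsto_subseq hU
  refine ⟨coords U₀, ⟨U₀, hU₀, rfl⟩, ?_⟩
  have key : ∀ (B : ℕ → Matrix (Fin 2) (Fin 2) ℂ) (B₀ : Matrix (Fin 2) (Fin 2) ℂ),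
      (∀ n, opNorm (B n) ≤ 1) → opNorm B₀ ≤ 1 → Tendsto B atTop (𝓝 B₀) →
      Tendsto (fun n => ‖f (coords ((r (φ n) : ℂ) • B n))‖) atTop (𝓝 ‖f (coords B₀)‖) := by
    intro B B₀ hB hB₀ hlimB
    refine ((hcont (coords B₀) ⟨B₀, hB₀, rfl⟩).tendsto.comp
      (tendsto_nhdsWithin_iff.mpr ⟨?_, Eventually.of_forall fun n => ⟨_, ?_, rfl⟩⟩)).norm
    · have := (hrlim.comp hφ.tendsto_atTop).smul hlimB
      rw [one_smul] at this
      exact (continuous_coords.tendsto B₀).comp this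
    · rw [opNorm_smul, Complex.norm_real, Real.norm_of_nonneg (hr0 _).le]
      exact mul_le_one₀ (hr1 _).le (norm_nonneg _) (hB n)
  exact le_of_tendsto_of_tendsto' (key (fun _ => A) A (fun _ => hA) hA tendsto_const_nhds)
    (key (fun n => U (φ n)) U₀ (fun n => (opNorm_of_mem_unitaryGroup (hU _)).le)
      (opNorm_of_mem_unitaryGroup hU₀).le hlim) fun n => hle (φ n)

/-- The points of the distinguished boundary are coordinates of unitary matrices, hence satisfy
`|z₃| = 1` and `z₂ = z̄₂ z₃`. Only this inclusion is needed, not a description of the boundary. -/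
lemma star_mul_self_and_eq_of_mem_distinguishedBoundary {z : Fin 3 → ℂ}
    (hz : z ∈ distinguishedBoundary) :
    star (z 2) * z 2 = 1 ∧ z 1 = star (z 1) * z 2 := by
  obtain ⟨U, hU, rfl⟩ := hz _ isClosedBoundary_unitaryCoords
  have h1 : star U.det * U.det = 1 := by
    have := congrArg det (mem_unitaryGroup_iff'.mp hU)
    rwa [det_mul, star_eq_conjTranspose, det_conjTranspose, det_one] at this
  refine ⟨h1, ?_⟩
  -- `U* det U` is the adjugate of `U`, and the adjugate has the same trace as `U`.
  have h2 : star U * (U.det • (1 : Matrix (Fin 2) (Fin 2) ℂ)) = adjugate U := by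
    rw [← mul_adjugate, ← mul_assoc, mem_unitaryGroup_iff'.mp hU, one_mul]
  have h3 : U.det * star U.trace = U.trace := by
    have := congrArg trace h2
    rw [Matrix.mul_smul, mul_one, trace_smul, star_eq_conjTranspose, trace_conjTranspose,
      smul_eq_mul, trace_fin_two (adjugate U), adjugate_fin_two] at this
    rw [this, trace_fin_two U]
    simp [add_comm]
  simp only [coords, cons_val]
  rw [mul_comm, h3]

end Boundary

/-! ### Relations satisfied by pentablock unitaries -/

section Gelfand

open WeakDual

variable {H : Type u} [NormedAddCommGroup H] [InnerProductSpace ℂ H] [CompleteSpace H]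

/-- If the row operator `(T₁, T₂, T₃) : H³ → H` is onto, then `∑ Tᵢ Tᵢ*` is invertible: by the
open mapping theorem it is bounded below. -/
lemma isUnit_sum_mul_adjoint {T : Fin 3 → H →L[ℂ] H} (hT : Function.Surjective (koszul₂ T)) :
    IsUnit (∑ i, T i * star (T i)) := by
  let S : (Fin 3 → H) →L[ℂ] H := ∑ i, T i ∘L ContinuousLinearMap.proj i
  have hS : ∀ x, S x = koszul₂ T x := fun x => by simp [S, koszul₂]
  obtain ⟨C, hC, hpre⟩ := S.exists_preimage_norm_le fun y => by
    obtain ⟨x, hx⟩ := hT y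
    exact ⟨x, (hS x).trans hx⟩
  have hsq : ∀ y, inner ℂ ((∑ i, T i * star (T i)) y) y = ((∑ i, ‖((T i)†) y‖ ^ 2 : ℝ) : ℂ) := by
    intro y
    simp only [_root_.sum_apply, sum_inner, Complex.ofReal_sum]
    refine Finset.sum_congr rfl fun i _ => ?_
    rw [mul_apply_eq_comp, ContinuousLinearMap.star_eq_adjoint,
      ← ContinuousLinearMap.adjoint_inner_right, inner_self_eq_norm_sq_to_K]
    norm_cast
  have hbd : ∀ y, ‖y‖ ^ 2 ≤ 3 * C ^ 2 * ∑ i, ‖((T i)†) y‖ ^ 2 := by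
    intro y
    obtain ⟨x, hx, hxn⟩ := hpre y
    have h1 : ‖y‖ ^ 2 ≤ ∑ i, ‖((T i)†) y‖ * (C * ‖y‖) := by
      have : ((‖y‖ ^ 2 : ℝ) : ℂ) = ∑ i, inner ℂ (((T i)†) y) (x i) := by
        have h := inner_self_eq_norm_sq_to_K (𝕜 := ℂ) y
        nth_rewrite 2 [← hx] at h
        rw [hS, koszul₂, inner_sum] at h
        simp only [ContinuousLinearMap.adjoint_inner_left]
        rw [h]
        norm_cast
      calc ‖y‖ ^ 2 = ‖((‖y‖ ^ 2 : ℝ) : ℂ)‖ := by rw [Complex.norm_real]; simp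
        _ ≤ ∑ i, ‖inner ℂ (((T i)†) y) (x i)‖ := by rw [this]; exact norm_sum_le _ _
        _ ≤ ∑ i, ‖((T i)†) y‖ * (C * ‖y‖) := Finset.sum_le_sum fun i _ =>
          (norm_inner_le_norm _ _).trans <| by
            gcongr
            exact (norm_le_pi_norm x i).trans hxn
    have h2 : ‖y‖ ^ 2 * 1 ≤ ‖y‖ * (C * ∑ i, ‖((T i)†) y‖) := by
      refine (mul_one _).le.trans (h1.trans_eq ?_)
      rw [← Finset.sum_mul]
      ring
    have h3 : ‖y‖ ≤ C * ∑ i, ‖((T i)†) y‖ := by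
      rcases (norm_nonneg y).eq_or_lt with h | h
      · rw [← h]; positivity
      · exact le_of_mul_le_mul_left (by nlinarith) h
    calc ‖y‖ ^ 2 ≤ (C * ∑ i, ‖((T i)†) y‖) ^ 2 := by gcongr
      _ = C ^ 2 * (∑ i, ‖((T i)†) y‖) ^ 2 := by ring
      _ ≤ C ^ 2 * (3 * ∑ i, ‖((T i)†) y‖ ^ 2) := by
        gcongr
        simpa using sq_sum_le_card_mul_sum_sq (s := Finset.univ) (f := fun i => ‖((T i)†) y‖)
      _ = _ := by ring
  have hc : 0 < 3 * C ^ 2 := by positivity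
  refine ContinuousLinearMap.isUnit_of_forall_le_norm_inner_map _
    (c := ⟨(3 * C ^ 2)⁻¹, by positivity⟩) (by exact inv_pos.mpr hc) fun y => ?_
  rw [hsq, Complex.norm_real, Real.norm_of_nonneg (by positivity)]
  change ‖y‖ ^ 2 * (3 * C ^ 2)⁻¹ ≤ _
  rw [mul_comm, inv_mul_le_iff₀ hc]
  exact hbd y

/-- A character of a commutative C⋆-algebra of operators sends a commuting triple of its elements
to a point of the Taylor spectrum: at that point `∑ (Tᵢ - zᵢ)(Tᵢ - zᵢ)*` is not invertible, so
that the last map of the Koszul complex is not onto. -/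
lemma mem_taylorSpectrum_of_starAlgHom (S : StarSubalgebra ℂ (H →L[ℂ] H))
    [IsClosed (S : Set (H →L[ℂ] H))] (U : Fin 3 → S) (φ : S →⋆ₐ[ℂ] ℂ) :
    (fun i => φ (U i)) ∈ taylorSpectrum fun i => (U i : H →L[ℂ] H) := by
  intro hex
  have hunit := isUnit_sum_mul_adjoint hex.2.2.2
  set s : S := ∑ i, (U i - φ (U i) • 1) * star (U i - φ (U i) • 1) with hs
  have hcoe : (s : H →L[ℂ] H) = ∑ i, ((U i : H →L[ℂ] H) - φ (U i) • 1) *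
      star ((U i : H →L[ℂ] H) - φ (U i) • 1) := by
    simp [hs]
  rw [← hcoe, StarSubalgebra.coe_isUnit] at hunit
  have h0 : φ s = 0 := by
    simp [hs]
  have := hunit.map φ
  rw [h0] at this
  exact not_isUnit_zero this

/-- Gelfand duality: the characters of a commutative C⋆-algebra of operators separate its
elements. -/
lemma eq_zero_of_forall_starAlgHom (S : StarSubalgebra ℂ (H →L[ℂ] H))
    [IsClosed (S : Set (H →L[ℂ] H))] (hcomm : ∀ a b : S, a * b = b * a) (a : S)
    (ha : ∀ φ : S →⋆ₐ[ℂ] ℂ, φ a = 0) : a = 0 := by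
  let _ : CommCStarAlgebra S := { StarSubalgebra.cstarAlgebra S with mul_comm := hcomm }
  refine (gelfandTransform_isometry S).injective ?_
  rw [map_zero]
  ext φ
  exact ha { (φ : S →ₐ[ℂ] ℂ) with map_star' := fun x => map_star φ x }

/-- A pentablock unitary satisfies `U₃* U₃ = 1` and `U₂ = U₂* U₃`, because the points of the
distinguished boundary satisfy `z̄₃ z₃ = 1` and `z₂ = z̄₂ z₃`. By the Fuglede theorem the `Uᵢ`
generate a commutative C⋆-algebra, where such relations may be checked on characters. -/
lemma adjoint_mul_self_and_eq_of_isPentablockUnitary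
    {U : Fin 3 → H →L[ℂ] H} (hU : IsPentablockUnitary U) :
    star (U 2) * U 2 = 1 ∧ U 1 = star (U 1) * U 2 := by
  obtain ⟨⟨hc, hn⟩, hspec⟩ := hU
  have := StarAlgebra.isMulCommutative_adjoin ℂ (s := Set.range U)
    (by rintro _ ⟨i, rfl⟩ _ ⟨j, rfl⟩; exact hc i j)
    (by rintro _ ⟨i, rfl⟩ _ ⟨j, rfl⟩; exact (hn j).commute_star_right (hc i j))
  set S : StarSubalgebra ℂ (H →L[ℂ] H) :=
    (StarAlgebra.adjoin ℂ (Set.range U)).topologicalClosure with hS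
  have : IsClosed (S : Set (H →L[ℂ] H)) := StarSubalgebra.isClosed_topologicalClosure _
  have hcomm : ∀ a b : S, a * b = b * a :=
    (StarSubalgebra.commRingTopologicalClosure _ fun x y => mul_comm' x y).mul_comm
  let V : Fin 3 → S := fun i =>
    ⟨U i, StarSubalgebra.le_topologicalClosure _ (StarAlgebra.subset_adjoin ℂ _ ⟨i, rfl⟩)⟩
  have hφ := fun φ : S →⋆ₐ[ℂ] ℂ =>
    star_mul_self_and_eq_of_mem_distinguishedBoundary <| hspec (mem_taylorSpectrum_of_starAlgHom S V φ)
  have h1 := eq_zero_of_forall_starAlgHom S hcomm (star (V 2) * V 2 - 1) fun φ => by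
    rw [map_sub, map_mul, map_star, map_one, (hφ φ).1, sub_self]
  have h2 := eq_zero_of_forall_starAlgHom S hcomm (V 1 - star (V 1) * V 2) fun φ => by
    rw [map_sub, map_mul, map_star, ← (hφ φ).2, sub_self]
  exact ⟨congrArg Subtype.val (sub_eq_zero.mp h1), congrArg Subtype.val (sub_eq_zero.mp h2)⟩

end Gelfand

/-! ### Pentablock isometries and isometric dilations -/

/-- The relations `R₃* R₃ = 1` and `R₂ = R₂* R₃` in weak form; they pass from a pentablock unitary
to its restriction to an invariant subspace. -/
lemma inner_eq_of_isPentablockIsometry {K : Type u} [NormedAddCommGroup K]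
    [InnerProductSpace ℂ K] {R : Fin 3 → K →L[ℂ] K} (hR : IsPentablockIsometry R)
    (x y : K) :
    inner ℂ (R 2 x) (R 2 y) = inner ℂ x y ∧ inner ℂ x (R 1 y) = inner ℂ (R 1 x) (R 2 y) := by
  obtain ⟨L, _, _, _, J, U, hU, hJ⟩ := hR
  obtain ⟨h1, h2⟩ := adjoint_mul_self_and_eq_of_isPentablockUnitary hU
  constructor
  · rw [← J.inner_map_map, ← hJ, ← hJ, ← ContinuousLinearMap.adjoint_inner_right,
      ← J.inner_map_map x y]
    exact congrArg (inner ℂ (J x)) (DFunLike.congr_fun h1 (J y))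
  · rw [← J.inner_map_map, ← hJ, ← J.inner_map_map (R 1 x), ← hJ, ← hJ,
      ← ContinuousLinearMap.adjoint_inner_right]
    exact congrArg (inner ℂ (J x)) (DFunLike.congr_fun h2 (J y))

lemma inner_map_coe_orthogonal_range {H K : Type u} [NormedAddCommGroup H]
    [InnerProductSpace ℂ H] [NormedAddCommGroup K] [InnerProductSpace ℂ K] {J : H →ₗᵢ[ℂ] K}
    (x : H) (u : (LinearMap.range J.toLinearMap)ᗮ) :
    inner ℂ (J x) (u : K) = 0 :=
  u.2 _ ⟨x, rfl⟩

section Dilation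

variable {H K : Type u} [NormedAddCommGroup H] [InnerProductSpace ℂ H] [CompleteSpace H]
  [NormedAddCommGroup K] [InnerProductSpace ℂ K] [CompleteSpace K]

lemma denseRange_defectMap (T : H →L[ℂ] H) : DenseRange (defectMap T) := by
  intro x
  rw [closure_subtype]
  have hx : (x : H) ∈ closure (Set.range (defectOp T)) := x.2
  convert hx using 2
  ext y
  constructor
  · rintro ⟨_, ⟨h, rfl⟩, rfl⟩
    exact ⟨h, rfl⟩
  · rintro ⟨h, rfl⟩
    exact ⟨defectMap T h, ⟨h, rfl⟩, rfl⟩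

lemma inner_defectOp_left (T : H →L[ℂ] H) (x y : H) :
    inner ℂ (defectOp T x) y = inner ℂ x (defectOp T y) :=
  ((ContinuousLinearMap.nonneg_iff_isPositive _).mp
    (CFC.sqrt_nonneg (1 - (T†) * T))).inner_left_eq_inner_right x y

lemma inner_defectMap_defectMap {T : H →L[ℂ] H} (hT : ∀ x, ‖T x‖ ≤ ‖x‖) (x y : H) :
    inner ℂ (defectMap T x) (defectMap T y) = inner ℂ x y - inner ℂ (T x) (T y) := by
  have hnn : 0 ≤ 1 - (T†) * T := by
    have : ‖T‖ ≤ 1 := T.opNorm_le_bound zero_le_one fun x => by simpa using hT x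
    rw [sub_nonneg]
    refine (CStarAlgebra.norm_le_one_iff_of_nonneg ((T†) * T) (star_mul_self_nonneg T)).mp ?_
    exact (CStarRing.norm_star_mul_self (x := T)).trans_le (mul_le_one₀ this (norm_nonneg _) this)
  have hsq : defectOp T * defectOp T = 1 - (T†) * T := CFC.sqrt_mul_sqrt_self _ hnn
  calc inner ℂ (defectMap T x) (defectMap T y)
      = inner ℂ (defectOp T x) (defectOp T y) := rfl
    _ = inner ℂ x ((defectOp T * defectOp T) y) := inner_defectOp_left T x _
    _ = inner ℂ x y - inner ℂ (T x) (T y) := by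
      rw [hsq, ← ContinuousLinearMap.adjoint_inner_right T]
      simp

/-- The fundamental equation `P₂ - P₂* P₃ = D X D` in weak form. -/
lemma inner_defectMap_apply {P : Fin 3 → H →L[ℂ] H}
    {X : DefectSpace (P 2) →L[ℂ] DefectSpace (P 2)} (hX : IsFundamentalOperator P X) (x y : H) :
    inner ℂ (defectMap (P 2) x) (X (defectMap (P 2) y)) =
      inner ℂ x (P 1 y) - inner ℂ (P 1 x) (P 2 y) := by
  have h := DFunLike.congr_fun hX y
  calc inner ℂ (defectMap (P 2) x) (X (defectMap (P 2) y))
      = inner ℂ (defectOp (P 2) x) (X (defectMap (P 2) y) : H) := rfl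
    _ = inner ℂ x ((P 1 - ((P 1)†) * P 2) y) := by
      rw [inner_defectOp_left, h]
      rfl
    _ = _ := by
      rw [← ContinuousLinearMap.adjoint_inner_right (P 1)]
      simp

lemma eq_of_forall_inner_defectMap {T : H →L[ℂ] H} {u v : DefectSpace T}
    (h : ∀ x, inner ℂ (defectMap T x) u = inner ℂ (defectMap T x) v) : u = v :=
  (denseRange_defectMap T).eq_of_inner_right ℂ h

lemma ext_of_forall_inner_defectMap {T : H →L[ℂ] H} {X Y : DefectSpace T →L[ℂ] DefectSpace T}
    (h : ∀ x y, inner ℂ (defectMap T x) (X (defectMap T y)) =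
      inner ℂ (defectMap T x) (Y (defectMap T y))) : X = Y :=
  ContinuousLinearMap.coeFn_injective <| (denseRange_defectMap T).equalizer X.continuous
    Y.continuous <| funext fun y => eq_of_forall_inner_defectMap fun x => h x y

/-- A bounded map `E` with `‖E x‖ = ‖D_T x‖` factors through `D_T` by an isometry of the defect
space. -/
lemma exists_linearIsometry_comp_defectMap {T : H →L[ℂ] H} (E : H →L[ℂ] K)
    (hE : ∀ x, ‖E x‖ = ‖defectMap T x‖) :
    ∃ Θ : DefectSpace T →ₗᵢ[ℂ] K, ∀ x, Θ (defectMap T x) = E x := by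
  have hd : DenseRange (defectMap T : H →ₗ[ℂ] DefectSpace T) := denseRange_defectMap T
  set Θ := LinearMap.extendOfNorm (E : H →ₗ[ℂ] K) (defectMap T : H →ₗ[ℂ] DefectSpace T)
  have hΘ : ∀ x, Θ (defectMap T x) = E x := fun x =>
    LinearMap.extendOfNorm_eq hd ⟨1, fun x => by simpa using (hE x).le⟩ x
  refine ⟨⟨Θ, fun u => ?_⟩, hΘ⟩
  have : (fun u => ‖Θ u‖) = fun u => ‖u‖ :=
    (denseRange_defectMap T).equalizer (by fun_prop) (by fun_prop) <| funext fun x => by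
      simp only [Function.comp_apply, hΘ, hE]
  exact congrFun this u

variable {P : Fin 3 → H →L[ℂ] H} {R : Fin 3 → K →L[ℂ] K} {J : H →ₗᵢ[ℂ] K}

/-- If `Rᵢ*` extends `Pᵢ*`, then `P` is the compression of `R`; moreover the orthogonal complement
of `H`, the kernel of `J*`, is invariant under `R`. -/
lemma adjoint_apply_of_coextension (h : ∀ i x, ((R i)†) (J x) = J (((P i)†) x)) (i : Fin 3)
    (y : K) :
    (J.toContinuousLinearMap†) (R i y) = P i ((J.toContinuousLinearMap†) y) := by
  refine ext_inner_left ℂ fun x => ?_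
  have := h i x
  rw [ContinuousLinearMap.adjoint_inner_right, ← ContinuousLinearMap.adjoint_inner_left (P i),
    ContinuousLinearMap.adjoint_inner_right, ← ContinuousLinearMap.adjoint_inner_left (R i)]
  exact congrArg (inner ℂ · y) this

lemma adjoint_apply_self (x : H) : (J.toContinuousLinearMap†) (J x) = x := by
  refine ext_inner_left ℂ fun y => ?_
  rw [ContinuousLinearMap.adjoint_inner_right]
  exact J.inner_map_map y x

lemma inner_apply_of_coextension (h : ∀ i x, ((R i)†) (J x) = J (((P i)†) x)) (i : Fin 3)
    (x y : H) : inner ℂ (J x) (R i (J y)) = inner ℂ x (P i y) := by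
  have := ContinuousLinearMap.adjoint_inner_right J.toContinuousLinearMap x (R i (J y))
  rw [adjoint_apply_of_coextension h, adjoint_apply_self] at this
  exact this.symm

lemma inner_apply_left_of_coextension (h : ∀ i x, ((R i)†) (J x) = J (((P i)†) x)) (i : Fin 3)
    (x y : H) : inner ℂ (R i (J x)) (J y) = inner ℂ (P i x) y := by
  rw [← inner_conj_symm, inner_apply_of_coextension h, inner_conj_symm]

/-- The defect vector `R₃ h - P₃ h` of `h`, where `H` is regarded as a subspace of `K`. It lies in
the orthogonal complement of `H`. -/
def dilationDefect (h : ∀ i x, ((R i)†) (J x) = J (((P i)†) x)) :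
    H →L[ℂ] (LinearMap.range J.toLinearMap)ᗮ :=
  (R 2 ∘L J.toContinuousLinearMap - J.toContinuousLinearMap ∘L P 2).codRestrict _ <| by
    rintro y _ ⟨x, rfl⟩
    change inner ℂ (J x) (R 2 (J y) - J (P 2 y)) = 0
    rw [inner_sub_right, inner_apply_of_coextension h, J.inner_map_map, sub_self]

/-- The restriction of a coextension to the orthogonal complement of `H`, an invariant
subspace. -/
def orthogonalRestriction (h : ∀ i x, ((R i)†) (J x) = J (((P i)†) x)) (i : Fin 3) :
    (LinearMap.range J.toLinearMap)ᗮ →L[ℂ] (LinearMap.range J.toLinearMap)ᗮ :=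
  (R i ∘L Submodule.subtypeL _).codRestrict _ <| by
    rintro ⟨y, hy⟩ _ ⟨x, rfl⟩
    change inner ℂ (J x) (R i y) = 0
    rw [← ContinuousLinearMap.adjoint_inner_left, h]
    exact hy _ ⟨_, rfl⟩

/-- The map `dilationDefect` has the same Gram form `⟪x, y⟫ - ⟪P₃ x, P₃ y⟫` as the defect
operator; this is what embeds the defect space in the orthogonal complement of `H`. -/
lemma inner_dilationDefect (hR : IsPentablockIsometry R)
    (h : ∀ i x, ((R i)†) (J x) = J (((P i)†) x)) (x y : H) :
    inner ℂ (dilationDefect h x) (dilationDefect h y) = inner ℂ x y - inner ℂ (P 2 x) (P 2 y) := by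
  calc inner ℂ (dilationDefect h x) (dilationDefect h y)
      = inner ℂ (R 2 (J x) - J (P 2 x)) (dilationDefect h y : K) := rfl
    _ = inner ℂ (R 2 (J x)) (R 2 (J y) - J (P 2 y)) := by
      rw [inner_sub_left, inner_map_coe_orthogonal_range, sub_zero]
      rfl
    _ = inner ℂ x y - inner ℂ (P 2 x) (P 2 y) := by
      rw [inner_sub_right, (inner_eq_of_isPentablockIsometry hR _ _).1, J.inner_map_map,
        inner_apply_left_of_coextension h]

lemma norm_apply_le_of_isPentablockIsometry (hR : IsPentablockIsometry R)
    (h : ∀ i x, ((R i)†) (J x) = J (((P i)†) x)) (x : H) : ‖P 2 x‖ ≤ ‖x‖ := by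
  have hx := congrArg Complex.re (inner_dilationDefect hR h x x)
  simp only [inner_self_eq_norm_sq_to_K, Complex.sub_re, Complex.coe_algebraMap,
    ← Complex.ofReal_pow, Complex.ofReal_re] at hx
  exact le_of_sq_le_sq (by nlinarith [sq_nonneg ‖dilationDefect h x‖]) (norm_nonneg x)

lemma norm_dilationDefect (hR : IsPentablockIsometry R)
    (h : ∀ i x, ((R i)†) (J x) = J (((P i)†) x)) (x : H) :
    ‖dilationDefect h x‖ = ‖defectMap (P 2) x‖ := by
  have := (inner_dilationDefect hR h x x).trans (inner_defectMap_defectMap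
    (norm_apply_le_of_isPentablockIsometry hR h) x x).symm
  rw [@norm_eq_sqrt_re_inner ℂ, this, ← @norm_eq_sqrt_re_inner ℂ]

/-- The computation behind the first assertion: between defect vectors, `R₂` on the orthogonal
complement of `H` has the same matrix entries as `P₂ - P₂* P₃`. -/
lemma inner_dilationDefect_orthogonalRestriction (hc : IsCommuting R)
    (hR : IsPentablockIsometry R) (h : ∀ i x, ((R i)†) (J x) = J (((P i)†) x)) (x y : H) :
    inner ℂ (dilationDefect h x) (orthogonalRestriction h 1 (dilationDefect h y)) =
      inner ℂ x (P 1 y) - inner ℂ (P 1 x) (P 2 y) := by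
  have hcomm : R 1 (R 2 (J y)) = R 2 (R 1 (J y)) := DFunLike.congr_fun (hc 1 2) (J y)
  calc inner ℂ (dilationDefect h x) (orthogonalRestriction h 1 (dilationDefect h y))
      = inner ℂ (R 2 (J x) - J (P 2 x))
          (orthogonalRestriction h 1 (dilationDefect h y) : K) := rfl
    _ = inner ℂ (R 2 (J x)) (R 1 (R 2 (J y) - J (P 2 y))) := by
      rw [inner_sub_left, inner_map_coe_orthogonal_range, sub_zero]
      rfl
    _ = inner ℂ (J x) (R 1 (J y)) - inner ℂ (R 1 (J x)) (J (P 2 y)) := by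
      rw [map_sub, inner_sub_right, hcomm, (inner_eq_of_isPentablockIsometry hR _ _).1,
        ← inner_conj_symm (R 2 (J x)) (R 1 _), ← (inner_eq_of_isPentablockIsometry hR _ _).2,
        inner_conj_symm]
    _ = inner ℂ x (P 1 y) - inner ℂ (P 1 x) (P 2 y) := by
      rw [inner_apply_of_coextension h, inner_apply_left_of_coextension h]

/-- On the kernel of the defect operator, `R₃` agrees with `P₃`, so that the isometry relation
`R₂ = R₂* R₃`, compressed to `H`, involves `P` alone. -/
lemma inner_apply_of_defectOp_eq_zero (hR : IsPentablockIsometry R)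
    (h : ∀ i x, ((R i)†) (J x) = J (((P i)†) x)) {x : H} (hx : defectOp (P 2) x = 0) (y : H) :
    inner ℂ (P 2 x) (P 1 y) = inner ℂ (P 1 x) y := by
  have hx0 : defectMap (P 2) x = 0 := Subtype.ext hx
  have hd : dilationDefect h x = 0 := by
    rw [← norm_eq_zero, norm_dilationDefect hR, hx0, norm_zero]
  have hRx : R 2 (J x) = J (P 2 x) := sub_eq_zero.mp (congrArg Subtype.val hd)
  rw [← inner_apply_of_coextension h, ← hRx, ← inner_conj_symm,
    ← (inner_eq_of_isPentablockIsometry hR _ _).2, inner_conj_symm,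
    inner_apply_left_of_coextension h]

end Dilation

end Pentablock

end

open Pentablock in
theorem mainTheorem3 {H : Type u} [NormedAddCommGroup H] [InnerProductSpace ℂ H] [CompleteSpace H]
    (P : Fin 3 → H →L[ℂ] H) (hP : IsPentablockContraction P)
    (X : DefectSpace (P 2) →L[ℂ] DefectSpace (P 2)) (hX : IsFundamentalOperator P X)
    (hdil : HasPentablockIsometricDilation P) :
    (∃ (F : Type u) (_ : NormedAddCommGroup F) (_ : InnerProductSpace ℂ F) (_ : CompleteSpace F)
      (Θ : DefectSpace (P 2) →ₗᵢ[ℂ] F) (N : Fin 3 → F →L[ℂ] F),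
      X = (Θ.toContinuousLinearMap†) ∘L N 1 ∘L Θ.toContinuousLinearMap ∧
      (∀ i, IsSubnormalOperator (N i)) ∧ IsCommuting N ∧
      ∃ (L : Type u) (_ : NormedAddCommGroup L) (_ : InnerProductSpace ℂ L) (_ : CompleteSpace L)
        (J : F →ₗᵢ[ℂ] L) (U : Fin 3 → L →L[ℂ] L),
        IsCommutingNormal U ∧ (∀ i x, U i (J x) = J (N i x)) ∧
        taylorSpectrum U ⊆ distinguishedBoundary) ∧
    ∀ x : H, defectOp (P 2) x = 0 →
      (X†) (defectMap (P 2) (P 2 x)) - defectMap (P 2) (P 1 x) = 0 := by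
  obtain ⟨K, _, _, _, J, R, hc, hR, h⟩ := hdil
  refine ⟨?_, fun x hx => ?_⟩
  · obtain ⟨Θ, hΘ⟩ := exists_linearIsometry_comp_defectMap (dilationDefect h)
      (norm_dilationDefect hR h)
    obtain ⟨L, _, _, _, J', U, hU, hJ'⟩ := hR
    have hR : IsPentablockIsometry R := ⟨L, _, _, _, J', U, hU, hJ'⟩
    let ι : (LinearMap.range J.toLinearMap)ᗮ →ₗᵢ[ℂ] L := J'.comp (Submodule.subtypeₗᵢ _)
    have hι : ∀ i x, U i (ι x) = ι (orthogonalRestriction h i x) := fun i x => hJ' i x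
    refine ⟨(LinearMap.range J.toLinearMap)ᗮ, inferInstance, inferInstance, inferInstance, Θ,
      orthogonalRestriction h, ?_, fun i => ⟨L, _, _, _, ι, U i, hU.1.2 i, hι i⟩, fun i j => ?_,
      L, _, _, _, ι, U, hU.1, hι, hU.2⟩
    · refine ext_of_forall_inner_defectMap fun x y => ?_
      rw [inner_defectMap_apply hX, ← inner_dilationDefect_orthogonalRestriction hc hR h, ← hΘ,
        ← hΘ]
      exact (ContinuousLinearMap.adjoint_inner_right Θ.toContinuousLinearMap _ _).symm
    · ext x
      exact DFunLike.congr_fun (hc i j) (x : K)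
  · have hcP : P 1 (P 2 x) = P 2 (P 1 x) := DFunLike.congr_fun (hP.1 1 2) x
    refine sub_eq_zero.mpr <| (denseRange_defectMap (P 2)).eq_of_inner_left ℂ fun y => ?_
    rw [ContinuousLinearMap.adjoint_inner_left, inner_defectMap_apply hX,
      inner_defectMap_defectMap (norm_apply_le_of_isPentablockIsometry hR h),
      inner_apply_of_defectOp_eq_zero hR h hx, hcP]
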